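/- Let $\mathbf{k}$ be a field, let $k\in\mathbf{k}$ be a fixed nonzero scalar, and let $\mathcal{L}$ be a Lie algebra over $\mathbf{k}$ (of arbitrary dimension) with a basis $\{x_j \mid j\in J\}$ whose index set $J$ is totally ordered. Let $T$ be the free associative unital $\mathbf{k}$-algebra on the symbols $x_j$ ($j\in J$) and one further symbol $\tilde q$, and let $\hat A:=T/I$, where $I$ is the two-sided ideal generated by $\tilde q\tilde q-\tilde q$ and all $\tilde q a\tilde q-\tilde q a$ with $a\in T$. Write $\hat q$ and $\hat x_j$ for the images of $\tilde q$ and $x_j$ in $\hat A$, and let $\mathcal{L}\to\hat A$, $x\mapsto\hat x$, be the linear map with $x_j\mapsto\hat x_j$. For $u,v\in\hat A$ put $$[u,v]_{6,k}:=uv-vu-uv\hat q+vu\hat q+k\,u\hat q v-k\,v\hat q u .$$ Let $R$ be the two-sided ideal of $\hat A$ generated by all $\widehat{[x,y]}-[\hat x,\hat y]_{6,k}$ with $x,y\in\mathcal{L}$, and let $\mathcal{U}:=\hat A/R$ be the enveloping$^{6-th}$ algebra of $\mathcal{L}$. Then the following cosets of "model monomials" are pairwise distinct for different index data and form a $\mathbf{k}$-basis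 of $\mathcal{U}$: - $\hat q\,\hat x_{j_1}\cdots\hat x_{j_m}+R$, with $m\ge 0$ and $j_1\le\cdots\le j_m$; - $\hat x_{i_1}\cdots\hat x_{i_t}\,\hat x_{j_0}\,\hat q\,\hat x_{j_1}\cdots\hat x_{j_m}+R$, with $t,m\ge 0$, $i_1\le\cdots\le i_t$ and $j_0\le j_1\le\cdots\le j_m$; - $\hat x_{j_1}\cdots\hat x_{j_m}+R$, with $m\ge 0$ and $j_1\le\cdots\le j_m$. (Empty products are $1$.) -/

import Mathlib

/-- The bracket `[x, y]_{6,κ} = xy - yx - xyq + yxq + κ xqy - κ yqx` in an associative algebra `A`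
with a chosen element `q` (an idempotent in the applications). -/
def bracketSix {k A : Type*} [CommRing k] [Ring A] [Algebra k A] (κ : k) (q x y : A) : A :=
  x * y - y * x - x * y * q + y * x * q + κ • (x * q * y) - κ • (y * q * x)

/-- The relations `q̃ q̃ = q̃` and `q̃ a q̃ = q̃ a` (all `a`) on the free associative unital algebra
with generators `x_j` (`some j`) and `q̃` (`none`), that is, on the tensor algebra of the vector
space with basis `{x_j} ∪ {q̃}`. -/
inductive InvariantRel (k J : Type*) [Field k] :
    FreeAlgebra k (Option J) → FreeAlgebra k (Option J) → Prop
  | idem : InvariantRel k J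
      (FreeAlgebra.ι k none * FreeAlgebra.ι k none) (FreeAlgebra.ι k none)
  | inv (a : FreeAlgebra k (Option J)) : InvariantRel k J
      (FreeAlgebra.ι k none * a * FreeAlgebra.ι k none) (FreeAlgebra.ι k none * a)

/-- The free invariant algebra `Â` on the set `{x_j | j ∈ J}`: the quotient of the free algebra
by the two-sided ideal generated by all `q̃ q̃ - q̃` and `q̃ a q̃ - q̃ a`. -/
abbrev FreeInvariantAlgebra (k J : Type*) [Field k] : Type _ := RingQuot (InvariantRel k J)

namespace FreeInvariantAlgebra

/-- The idempotent `q̂` of `Â`. -/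
noncomputable def q (k J : Type*) [Field k] : FreeInvariantAlgebra k J :=
  RingQuot.mkAlgHom k (InvariantRel k J) (FreeAlgebra.ι k none)

/-- The generator `x̂_j` of `Â`. -/
noncomputable def x (k : Type*) {J : Type*} [Field k] (j : J) : FreeInvariantAlgebra k J :=
  RingQuot.mkAlgHom k (InvariantRel k J) (FreeAlgebra.ι k (some j))

/-- `q̂` is idempotent. -/
theorem q_mul_q (k J : Type*) [Field k] : q k J * q k J = q k J := by
  simpa [q] using RingQuot.mkAlgHom_rel k (InvariantRel.idem (k := k) (J := J))

/-- Every element of `Â` satisfies `q̂ a q̂ = q̂ a`, so that `(Â, q̂)` is all of `Â`. -/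
theorem q_mul_mul_q (k J : Type*) [Field k] (a : FreeInvariantAlgebra k J) :
    q k J * a * q k J = q k J * a := by
  obtain ⟨a, rfl⟩ := RingQuot.mkAlgHom_surjective k (InvariantRel k J) a
  simpa [q] using RingQuot.mkAlgHom_rel k (InvariantRel.inv (k := k) (J := J) a)

/-- The linear extension `x ↦ x̂` to a Lie algebra `L` of the map sending the basis vector `x_j`
to `x̂_j`. -/
noncomputable def hat {k J L : Type*} [Field k] [AddCommGroup L] [Module k L]
    (b : Module.Basis J k L) : L →ₗ[k] FreeInvariantAlgebra k J :=
  b.constr k (x k)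

/-- The monomial `x̂_{j₁} ⋯ x̂_{jₘ}`; it is `1` for the empty list. -/
noncomputable def word (k : Type*) {J : Type*} [Field k] (js : List J) :
    FreeInvariantAlgebra k J :=
  (js.map (x k)).prod

end FreeInvariantAlgebra

/-- The relations `[x, y]^ = [x̂, ŷ]_{6,κ}` (`x, y ∈ L`) on `Â`. -/
inductive EnvelopingSixRel {k J L : Type*} [Field k] [LieRing L] [LieAlgebra k L]
    (κ : k) (b : Module.Basis J k L) :
    FreeInvariantAlgebra k J → FreeInvariantAlgebra k J → Prop
  | lie (x y : L) : EnvelopingSixRel κ b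
      (FreeInvariantAlgebra.hat b ⁅x, y⁆)
      (bracketSix κ (FreeInvariantAlgebra.q k J)
        (FreeInvariantAlgebra.hat b x) (FreeInvariantAlgebra.hat b y))

/-- The enveloping algebra of sixth kind `U = Â / R`, where `R` is the two-sided ideal generated
by all `[x, y]^ - [x̂, ŷ]_{6,κ}`. -/
abbrev EnvelopingSix {k J L : Type*} [Field k] [LieRing L] [LieAlgebra k L]
    (κ : k) (b : Module.Basis J k L) : Type _ :=
  RingQuot (EnvelopingSixRel κ b)

/-- The projection `a ↦ a + R` from `Â` to `U = Â / R`. -/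
noncomputable def EnvelopingSix.coset {k J L : Type*} [Field k] [LieRing L] [LieAlgebra k L]
    (κ : k) (b : Module.Basis J k L) : FreeInvariantAlgebra k J →ₐ[k] EnvelopingSix κ b :=
  RingQuot.mkAlgHom k (EnvelopingSixRel κ b)

/-- The index data of the model monomials:
`qLeft js` for `q̂ x̂_{j₁} ⋯ x̂_{jₘ}` with `j₁ ≤ ⋯ ≤ jₘ`;
`qMid is j₀ js` for `x̂_{i₁} ⋯ x̂_{iₜ} x̂_{j₀} q̂ x̂_{j₁} ⋯ x̂_{jₘ}` with `i₁ ≤ ⋯ ≤ iₜ` and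
`j₀ ≤ j₁ ≤ ⋯ ≤ jₘ`; `noQ js` for `x̂_{j₁} ⋯ x̂_{jₘ}` with `j₁ ≤ ⋯ ≤ jₘ`. -/
inductive ModelMonomial (J : Type*) [LinearOrder J]
  | qLeft (js : List J) (hjs : js.Pairwise (· ≤ ·))
  | qMid (is : List J) (j₀ : J) (js : List J)
      (his : is.Pairwise (· ≤ ·)) (hjs : (j₀ :: js).Pairwise (· ≤ ·))
  | noQ (js : List J) (hjs : js.Pairwise (· ≤ ·))

/-- The element of `Â` given by a model monomial. -/
noncomputable def ModelMonomial.toFree (k : Type*) {J : Type*} [Field k] [LinearOrder J] :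
    ModelMonomial J → FreeInvariantAlgebra k J
  | .qLeft js _ => FreeInvariantAlgebra.q k J * FreeInvariantAlgebra.word k js
  | .qMid is j₀ js _ _ =>
      FreeInvariantAlgebra.word k is * FreeInvariantAlgebra.x k j₀ *
        FreeInvariantAlgebra.q k J * FreeInvariantAlgebra.word k js
  | .noQ js _ => FreeInvariantAlgebra.word k js

/-!
Write `p = 1 - q̂`. The relation `q̂ a q̂ = q̂ a` makes `x ↦ x̂ p` and `x ↦ κ x̂ q̂`
homomorphisms of Lie algebras from `L` to the enveloping algebra of sixth kind, so the words to
the left of `p` and those to the right of `q̂` can be sorted as in the universal enveloping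
algebra `U(L)`. Hence the adapted monomials, in which a factor `p` closes the word `i₁ ⋯ iₜ`,
span. They are independent because there is a representation by triangular `2 × 2` matrices over
`U(L) ⊗ U(L)` that sends them to distinct members of a basis, by the Poincaré–Birkhoff–Witt
theorem. The model monomials arise from the adapted ones by a unitriangular change, with respect
to the number of letters to the left of `q̂`.

The Poincaré–Birkhoff–Witt theorem holds for Lie algebras that are free over a commutative ring. It
is proved by the diamond lemma: in the tensor algebra, one relator `u (xy - yx - ⁅x, y⁆) v` for each
unsorted word `u x y v` and the sorted words themselves form a unitriangular modification of the
basis of all words, and confluence shows that the chosen relators span all of them.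
-/

/-! ### Unitriangular families and the diamond lemma -/

section Unitriangular

variable {R M ι α : Type*} [Ring R] [AddCommGroup M] [Module R M] [LinearOrder α]
  {v w : ι → M} {rk : ι → α}

theorem linearIndependent_of_unitriangular (hv : LinearIndependent R v)
    (h : ∀ i, w i - v i ∈ Submodule.span R (v '' {j | rk j < rk i})) :
    LinearIndependent R w := by
  rw [linearIndependent_iff]
  by_contra! ⟨c, hc, hc₀⟩
  obtain ⟨i, hi, hmax⟩ := c.support.exists_max_image rk (Finsupp.support_nonempty_iff.2 hc₀)
  have hlower : Finsupp.linearCombination R w c - Finsupp.linearCombination R v c ∈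
      Submodule.span R (v '' {j | rk j < rk i}) := by
    simp only [Finsupp.linearCombination_apply, Finsupp.sum, ← Finset.sum_sub_distrib, ← smul_sub]
    exact sum_mem fun j hj => Submodule.smul_mem _ _
      (Submodule.span_mono (Set.image_mono fun l hl => lt_of_lt_of_le hl (hmax j hj)) (h j))
  rw [hc, zero_sub, neg_mem_iff, Finsupp.mem_span_image_iff_linearCombination] at hlower
  obtain ⟨c', hc', hcc'⟩ := hlower
  rw [hv.finsuppLinearCombination_injective.eq_iff] at hcc'
  subst hcc'
  exact lt_irrefl _ ((Finsupp.mem_supported _ _).1 hc' hi)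

theorem span_le_span_of_unitriangular [WellFoundedLT α]
    (h : ∀ i, w i - v i ∈ Submodule.span R (v '' {j | rk j < rk i})) :
    Submodule.span R (Set.range v) ≤ Submodule.span R (Set.range w) := by
  refine Submodule.span_le.2 (Set.range_subset_iff.2 fun i => ?_)
  induction i using (InvImage.wf rk wellFounded_lt).induction with
  | _ i ih =>
    have hlower : w i - v i ∈ Submodule.span R (Set.range w) :=
      Submodule.span_le.2 (Set.image_subset_iff.2 ih) (h i)
    simpa using sub_mem (Submodule.subset_span (Set.mem_range_self i)) hlower

end Unitriangular

section DiamondLemma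

variable {R M W α : Type*} [Ring R] [AddCommGroup M] [Module R M] [LinearOrder α] [WellFoundedLT α]

/-- The linear form of Bergman's diamond lemma: choosing one relator for each reducible `w` is a
unitriangular change of basis, and by confluence the chosen relators span all relators. -/
theorem disjoint_span_irreducible_span_relators {B : W → M} (hB : LinearIndependent R B)
    {rk : W → α} {rel : W → Set M}
    (hlead : ∀ w, ∀ r ∈ rel w, r - B w ∈ Submodule.span R (B '' {w' | rk w' < rk w}))
    (hconf : ∀ w, ∀ r ∈ rel w, ∀ r' ∈ rel w,
      r - r' ∈ Submodule.span R (⋃ w' ∈ {w' | rk w' < rk w}, rel w')) :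
    Disjoint (Submodule.span R (B '' {w | rel w = ∅})) (Submodule.span R (⋃ w, rel w)) := by
  classical
  let v (w : W) : M := if h : (rel w).Nonempty then h.some else B w
  have v_mem {w : W} (h : (rel w).Nonempty) : v w ∈ rel w := by
    simpa only [v, dif_pos h] using h.some_mem
  have v_irreducible {w : W} (h : rel w = ∅) : v w = B w := by simp [v, h]
  have hv (w : W) : v w - B w ∈ Submodule.span R (B '' {w' | rk w' < rk w}) := by
    rcases (rel w).eq_empty_or_nonempty with h | h
    · simp [v_irreducible h]
    · exact hlead w _ (v_mem h)
  let N := Submodule.span R (v '' {w | (rel w).Nonempty})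
  have rel_subset (w : W) : rel w ⊆ N := by
    induction w using (InvImage.wf rk wellFounded_lt).induction with
    | _ w ih =>
      intro r hr
      have hlower : r - v w ∈ N :=
        Submodule.span_le.2 (Set.iUnion₂_subset ih) (hconf w r hr _ (v_mem ⟨r, hr⟩))
      simpa using add_mem hlower (Submodule.subset_span ⟨w, ⟨r, hr⟩, rfl⟩)
  have hdisj := (linearIndependent_of_unitriangular hB hv).disjoint_span_image
    (s := {w | rel w = ∅}) (t := {w | (rel w).Nonempty})
    (Set.disjoint_left.2 fun w hw hw' => hw'.ne_empty hw)
  have himage : v '' {w | rel w = ∅} = B '' {w | rel w = ∅} :=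
    Set.image_congr fun w hw => v_irreducible hw
  rw [himage] at hdisj
  exact hdisj.mono_right (Submodule.span_le.2 (Set.iUnion_subset rel_subset))

end DiamondLemma

/-! ### The Poincaré–Birkhoff–Witt theorem -/

section Words

variable {A B J : Type*}

/-- The monomial `f j₁ * ⋯ * f jₘ` attached to a word `[j₁, …, jₘ]`. -/
def wordProd [Monoid A] (f : J → A) (l : List J) : A := (l.map f).prod

@[simp]
theorem wordProd_nil [Monoid A] (f : J → A) : wordProd f [] = 1 := rfl

@[simp]
theorem wordProd_cons [Monoid A] (f : J → A) (j : J) (l : List J) :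
    wordProd f (j :: l) = f j * wordProd f l := List.prod_cons

@[simp]
theorem wordProd_append [Monoid A] (f : J → A) (l l' : List J) :
    wordProd f (l ++ l') = wordProd f l * wordProd f l' := by
  simp [wordProd]

theorem map_wordProd [Monoid A] [Monoid B] {F : Type*} [FunLike F A B] [MonoidHomClass F A B]
    (g : F) (f : J → A) (l : List J) : g (wordProd f l) = wordProd (fun j => g (f j)) l := by
  simp [wordProd, map_list_prod, Function.comp_def]

variable [LinearOrder J]

/-- The number of inversions of a word. -/
def inversions : List J → ℕ
  | [] => 0
  | x :: l => l.countP (· < x) + inversions l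

theorem inversions_swap_lt {x y : J} (hyx : y < x) (u v : List J) :
    inversions (u ++ y :: x :: v) < inversions (u ++ x :: y :: v) := by
  induction u with
  | nil =>
    simp only [List.nil_append, inversions, List.countP_cons, hyx, hyx.le.not_gt, decide_true,
      decide_false, if_true, Bool.false_eq_true, if_false]
    omega
  | cons z u ih =>
    have hcount : (u ++ y :: x :: v).countP (· < z) = (u ++ x :: y :: v).countP (· < z) :=
      ((List.Perm.swap x y v).append_left u).countP_eq _
    simpa only [List.cons_append, inversions, hcount, Nat.add_lt_add_iff_left] using ih

/-- The rank by which words decrease under rewriting: first the length, then the number of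
inversions. -/
def wordRank (l : List J) : ℕ ×ₗ ℕ := toLex (l.length, inversions l)

theorem wordRank_lt_of_length_lt {l l' : List J} (h : l.length < l'.length) :
    wordRank l < wordRank l' :=
  Prod.Lex.toLex_lt_toLex.2 (Or.inl h)

theorem wordRank_swap_lt {x y : J} (hyx : y < x) (u v : List J) :
    wordRank (u ++ y :: x :: v) < wordRank (u ++ x :: y :: v) :=
  Prod.Lex.toLex_lt_toLex.2 (Or.inr ⟨by simp, inversions_swap_lt hyx u v⟩)

theorem exists_descent_of_not_pairwise {l : List J} (h : ¬ l.Pairwise (· ≤ ·)) :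
    ∃ u v x y, y < x ∧ l = u ++ x :: y :: v := by
  rw [← List.isChain_iff_pairwise, List.isChain_iff_forall_rel_of_append_cons_cons] at h
  push Not at h
  obtain ⟨x, y, u, v, hl, hxy⟩ := h
  exact ⟨u, v, x, y, hxy, hl⟩

theorem not_lt_of_pairwise_append {u v : List J} {x y : J}
    (h : (u ++ x :: y :: v).Pairwise (· ≤ ·)) : ¬ y < x :=
  not_lt.2 (List.rel_of_pairwise_cons (List.pairwise_append.1 h).2.1 List.mem_cons_self)

end Words

section TensorBasis

theorem map_mem_of_forall_basis {R M N J : Type*} [Semiring R] [AddCommMonoid M] [Module R M]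
    [AddCommMonoid N] [Module R N] (b : Module.Basis J R N) {S : Submodule R M} (F : N →ₗ[R] M)
    (h : ∀ j, F (b j) ∈ S) (a : N) : F a ∈ S := by
  have : ⊤ ≤ S.comap F := by
    rw [← b.span_eq, Submodule.span_le]
    rintro _ ⟨j, rfl⟩
    exact h j
  exact this Submodule.mem_top

theorem basisFreeMonoid_apply {R J : Type*} [CommSemiring R] (w : FreeMonoid J) :
    FreeAlgebra.basisFreeMonoid R J w = wordProd (FreeAlgebra.ι R) w.toList := by
  refine (MonoidAlgebra.lift_single _ _ _).trans ?_
  simp [wordProd, FreeMonoid.lift_apply]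

variable {R N J : Type*} [CommSemiring R] [AddCommMonoid N] [Module R N] (b : Module.Basis J R N)

/-- The words in the vectors of a basis of a module, as a basis of the tensor algebra. -/
noncomputable def wordBasis : Module.Basis (List J) R (TensorAlgebra R N) :=
  b.tensorAlgebra.reindex FreeMonoid.toList

theorem wordBasis_apply (l : List J) :
    wordBasis b l = wordProd (fun j => TensorAlgebra.ι R (b j)) l := by
  simp [wordBasis, Module.Basis.tensorAlgebra, basisFreeMonoid_apply, map_wordProd]

@[simp]
theorem wordBasis_nil : wordBasis b [] = 1 := by
  simp [wordBasis_apply]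

theorem wordBasis_cons (j : J) (l : List J) :
    wordBasis b (j :: l) = TensorAlgebra.ι R (b j) * wordBasis b l := by
  simp [wordBasis_apply]

theorem wordBasis_append (l l' : List J) :
    wordBasis b (l ++ l') = wordBasis b l * wordBasis b l' := by
  simp [wordBasis_apply]

end TensorBasis

section LieRelators

variable {R L J M : Type*} [CommRing R] [LieRing L] [LieAlgebra R L] [AddCommGroup M] [Module R M]

/-- The relator `a ⊗ c - c ⊗ a - ⁅a, c⁆` of the universal enveloping algebra, as a bilinear map. -/
noncomputable def lieRelator : L →ₗ[R] L →ₗ[R] TensorAlgebra R L :=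
  LinearMap.mk₂ R
    (fun a c => TensorAlgebra.ι R a * TensorAlgebra.ι R c
      - TensorAlgebra.ι R c * TensorAlgebra.ι R a - TensorAlgebra.ι R ⁅a, c⁆)
    (fun _ _ _ => by simp only [map_add, add_mul, mul_add, add_lie]; abel)
    (fun _ _ _ => by simp only [map_smul, smul_mul_assoc, mul_smul_comm, smul_lie, smul_sub])
    (fun _ _ _ => by simp only [map_add, add_mul, mul_add, lie_add]; abel)
    (fun _ _ _ => by simp only [map_smul, smul_mul_assoc, mul_smul_comm, lie_smul, smul_sub])

theorem lieRelator_apply (a c : L) :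
    lieRelator (R := R) a c = TensorAlgebra.ι R a * TensorAlgebra.ι R c
      - TensorAlgebra.ι R c * TensorAlgebra.ι R a - TensorAlgebra.ι R ⁅a, c⁆ := rfl

theorem lieRelator_self (a : L) : lieRelator (R := R) a a = 0 := by
  simp [lieRelator_apply]

theorem lieRelator_swap (a c : L) : lieRelator (R := R) c a = -lieRelator a c := by
  rw [lieRelator_apply, lieRelator_apply, ← lie_skew a c, map_neg]
  abel

theorem lieRelator_mul_sub_mul_lieRelator (x y z : L) :
    lieRelator (R := R) x y * TensorAlgebra.ι R z - TensorAlgebra.ι R x * lieRelator y z =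
      lieRelator x z * TensorAlgebra.ι R y - TensorAlgebra.ι R y * lieRelator x z
        + TensorAlgebra.ι R z * lieRelator x y - lieRelator y z * TensorAlgebra.ι R x
        - lieRelator ⁅x, y⁆ z + lieRelator ⁅x, z⁆ y + lieRelator x ⁅y, z⁆ := by
  have jacobi : TensorAlgebra.ι R ⁅x, ⁅y, z⁆⁆ =
      TensorAlgebra.ι R ⁅⁅x, y⁆, z⁆ - TensorAlgebra.ι R ⁅⁅x, z⁆, y⁆ := by
    rw [leibniz_lie x y z, map_add, ← lie_skew y ⁅x, z⁆, map_neg, sub_eq_add_neg]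
  simp only [lieRelator_apply, jacobi]
  noncomm_ring

theorem map_lieRelator_mem [LinearOrder J] (b : Module.Basis J R L) {S : Submodule R M}
    (F : TensorAlgebra R L →ₗ[R] M) (h : ∀ x y, y < x → F (lieRelator (b x) (b y)) ∈ S)
    (a c : L) : F (lieRelator a c) ∈ S := by
  refine map_mem_of_forall_basis b (F ∘ₗ lieRelator.flip c) (fun x => ?_) a
  refine map_mem_of_forall_basis b (F ∘ₗ lieRelator (b x)) (fun y => ?_) c
  rcases lt_trichotomy y x with hyx | rfl | hxy
  · exact h x y hyx
  · simp [lieRelator_self]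
  · simpa [lieRelator_swap (b y)] using h y x hxy

end LieRelators

section Confluence

variable {R L J : Type*} [CommRing R] [LieRing L] [LieAlgebra R L] (b : Module.Basis J R L)

variable [LinearOrder J]

/-- The relators `u ⊗ (x ⊗ y - y ⊗ x - ⁅x, y⁆) ⊗ v` with `y < x` whose leading word `u x y v` is
`w`. -/
def swapRelators (w : List J) : Set (TensorAlgebra R L) :=
  {r | ∃ u x y v, y < x ∧ w = u ++ x :: y :: v ∧
    r = wordBasis b u * lieRelator (b x) (b y) * wordBasis b v}

/-- The span of the swap relators with leading word below `w`. -/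
def lowerRelators (w : List J) : Submodule R (TensorAlgebra R L) :=
  Submodule.span R (⋃ w' ∈ {w' | wordRank w' < wordRank w}, swapRelators b w')

variable {b}

theorem swapRelators_eq_empty_of_pairwise {l : List J} (hl : l.Pairwise (· ≤ ·)) :
    swapRelators b l = ∅ := by
  refine Set.eq_empty_of_forall_notMem ?_
  rintro _ ⟨u, x, y, v, hyx, rfl, -⟩
  exact not_lt_of_pairwise_append hl hyx

theorem sub_wordBasis_mem_of_mem_swapRelators {w : List J} {r : TensorAlgebra R L}
    (hr : r ∈ swapRelators b w) :
    r - wordBasis b w ∈ Submodule.span R (wordBasis b '' {w' | wordRank w' < wordRank w}) := by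
  obtain ⟨u, x, y, v, hyx, rfl, rfl⟩ := hr
  let S := Submodule.span R (wordBasis b '' {w | wordRank w < wordRank (u ++ x :: y :: v)})
  have hswap : wordBasis b (u ++ y :: x :: v) ∈ S :=
    Submodule.subset_span ⟨_, wordRank_swap_lt hyx u v, rfl⟩
  have hbracket : wordBasis b u * TensorAlgebra.ι R ⁅b x, b y⁆ * wordBasis b v ∈ S :=
    map_mem_of_forall_basis b
      (LinearMap.mulLeftRight R (wordBasis b u, wordBasis b v) ∘ₗ TensorAlgebra.ι R)
      (S := S) (fun j => Submodule.subset_span ⟨u ++ j :: v, wordRank_lt_of_length_lt (by simp),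
        by simp [wordBasis_append, wordBasis_cons, mul_assoc]⟩) ⁅b x, b y⁆
  convert neg_mem (add_mem hswap hbracket) using 1
  simp only [lieRelator_apply, wordBasis_append, wordBasis_cons]
  noncomm_ring

section

variable {w u v : List J}

theorem swapRelator_mem_lowerRelators {x y : J} (hyx : y < x)
    (h : wordRank (u ++ x :: y :: v) < wordRank w) :
    wordBasis b u * lieRelator (b x) (b y) * wordBasis b v ∈ lowerRelators b w :=
  Submodule.subset_span (Set.mem_biUnion h ⟨u, x, y, v, hyx, rfl, rfl⟩)

theorem lieRelator_mem_lowerRelators (h : u.length + v.length + 2 < w.length) (a c : L) :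
    wordBasis b u * lieRelator a c * wordBasis b v ∈ lowerRelators b w :=
  map_lieRelator_mem b (LinearMap.mulLeftRight R (wordBasis b u, wordBasis b v))
    (fun _ _ hyx => swapRelator_mem_lowerRelators hyx
      (wordRank_lt_of_length_lt (by simp; omega))) a c

theorem overlapping_confluent {x y z : J} (hyx : y < x) (hzy : z < y) (u v : List J) :
    wordBasis b u * lieRelator (b x) (b y) * wordBasis b (z :: v)
      - wordBasis b (u ++ [x]) * lieRelator (b y) (b z) * wordBasis b v
        ∈ lowerRelators b (u ++ x :: y :: z :: v) := by
  have hxzy : wordRank (u ++ x :: z :: y :: v) < wordRank (u ++ x :: y :: z :: v) := by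
    simpa using wordRank_swap_lt hzy (u ++ [x]) v
  have hyxz := wordRank_swap_lt hyx u (z :: v)
  have hzxy := (wordRank_swap_lt (hzy.trans hyx) u (y :: v)).trans hxzy
  have hyzx : wordRank (u ++ y :: z :: x :: v) < wordRank (u ++ x :: y :: z :: v) := by
    refine lt_trans ?_ hyxz
    simpa using wordRank_swap_lt (hzy.trans hyx) (u ++ [y]) v
  have short (a c : L) : wordBasis b u * lieRelator a c * wordBasis b v
      ∈ lowerRelators b (u ++ x :: y :: z :: v) :=
    lieRelator_mem_lowerRelators (by simp; omega) a c
  have m₁ := swapRelator_mem_lowerRelators (b := b) (v := y :: v) (hzy.trans hyx) hxzy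
  have m₂ := swapRelator_mem_lowerRelators (b := b) (u := u ++ [y]) (hzy.trans hyx)
    (by simpa using hyxz)
  have m₃ := swapRelator_mem_lowerRelators (b := b) (u := u ++ [z]) hyx (by simpa using hzxy)
  have m₄ := swapRelator_mem_lowerRelators (b := b) (v := x :: v) hzy hyzx
  convert add_mem (add_mem (sub_mem (sub_mem (add_mem (sub_mem m₁ m₂) m₃) m₄)
    (short ⁅b x, b y⁆ (b z))) (short ⁅b x, b z⁆ (b y))) (short (b x) ⁅b y, b z⁆) using 1
  have := congrArg (wordBasis b u * · * wordBasis b v)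
    (lieRelator_mul_sub_mul_lieRelator (R := R) (b x) (b y) (b z))
  simpa only [wordBasis_append, wordBasis_cons, wordBasis_nil, mul_one, mul_add, mul_sub, add_mul,
    sub_mul, mul_assoc] using this

theorem disjoint_confluent {x y z t : J} (hyx : y < x) (htz : t < z) (u m v : List J) :
    wordBasis b u * lieRelator (b x) (b y) * wordBasis b (m ++ z :: t :: v)
      - wordBasis b (u ++ x :: y :: m) * lieRelator (b z) (b t) * wordBasis b v
        ∈ lowerRelators b (u ++ x :: y :: (m ++ z :: t :: v)) := by
  have h₁ := swapRelator_mem_lowerRelators (b := b) (u := u) (v := m ++ t :: z :: v)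
    (w := u ++ x :: y :: (m ++ z :: t :: v)) hyx
    (by simpa using wordRank_swap_lt htz (u ++ x :: y :: m) v)
  have h₂ := swapRelator_mem_lowerRelators (b := b) (u := u ++ y :: x :: m) (v := v)
    (w := u ++ x :: y :: (m ++ z :: t :: v)) htz
    (by simpa using wordRank_swap_lt hyx u (m ++ z :: t :: v))
  have h₃ := map_mem_of_forall_basis b (S := lowerRelators b (u ++ x :: y :: (m ++ z :: t :: v)))
    (LinearMap.mulLeftRight R
      (wordBasis b u * lieRelator (b x) (b y) * wordBasis b m, wordBasis b v) ∘ₗ TensorAlgebra.ι R)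
    (fun j => by
      simpa [wordBasis_append, wordBasis_cons, mul_assoc] using
        lieRelator_mem_lowerRelators (b := b) (u := u) (v := m ++ j :: v)
          (w := u ++ x :: y :: (m ++ z :: t :: v)) (by simp; omega) (b x) (b y)) ⁅b z, b t⁆
  have h₄ := map_mem_of_forall_basis b (S := lowerRelators b (u ++ x :: y :: (m ++ z :: t :: v)))
    (LinearMap.mulLeftRight R
      (wordBasis b u, wordBasis b m * lieRelator (b z) (b t) * wordBasis b v) ∘ₗ TensorAlgebra.ι R)
    (fun j => by
      simpa [wordBasis_append, wordBasis_cons, mul_assoc] using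
        lieRelator_mem_lowerRelators (b := b) (u := u ++ j :: m) (v := v)
          (w := u ++ x :: y :: (m ++ z :: t :: v)) (by simp; omega) (b z) (b t)) ⁅b x, b y⁆
  convert sub_mem (sub_mem (add_mem h₁ h₃) h₂) h₄ using 1
  simp only [wordBasis_append, wordBasis_cons, LinearMap.comp_apply, LinearMap.mulLeftRight_apply,
    lieRelator_apply]
  noncomm_ring

theorem swapRelators_confluent {r r' : TensorAlgebra R L} (hr : r ∈ swapRelators b w)
    (hr' : r' ∈ swapRelators b w) : r - r' ∈ lowerRelators b w := by
  obtain ⟨u₁, x₁, y₁, v₁, h₁, rfl, rfl⟩ := hr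
  obtain ⟨u₂, x₂, y₂, v₂, h₂, heq, rfl⟩ := hr'
  wlog hu : ∃ m, u₂ = u₁ ++ m ∧ x₁ :: y₁ :: v₁ = m ++ x₂ :: y₂ :: v₂ generalizing
    u₁ x₁ y₁ v₁ u₂ x₂ y₂ v₂
  · have hu' := (List.append_eq_append_iff.1 heq).resolve_left hu
    rw [heq, ← neg_sub]
    exact neg_mem (this u₂ x₂ y₂ v₂ h₂ u₁ x₁ y₁ v₁ h₁ heq.symm hu')
  obtain ⟨_ | ⟨c, _ | ⟨d, m⟩⟩, rfl, htail⟩ := hu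
  · obtain ⟨rfl, rfl, rfl⟩ : x₁ = x₂ ∧ y₁ = y₂ ∧ v₁ = v₂ := by simpa using htail
    simp
  · obtain ⟨rfl, rfl, rfl⟩ : x₁ = c ∧ y₁ = x₂ ∧ v₁ = y₂ :: v₂ := by simpa using htail
    exact overlapping_confluent h₁ h₂ u₁ v₂
  · obtain ⟨rfl, rfl, rfl⟩ : x₁ = c ∧ y₁ = d ∧ v₁ = m ++ x₂ :: y₂ :: v₂ := by simpa using htail
    exact disjoint_confluent h₁ h₂ u₁ m v₂

end

end Confluence

section PBW

variable {R L J A : Type*} [CommRing R] [LieRing L] [LieAlgebra R L] [Ring A] [Algebra R A]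

/-- The canonical map of a Lie algebra to its universal enveloping algebra, as a linear map. -/
noncomputable def envelopingι (R : Type*) {L : Type*} [CommRing R] [LieRing L] [LieAlgebra R L] :
    L →ₗ[R] UniversalEnvelopingAlgebra R L :=
  (UniversalEnvelopingAlgebra.mkAlgHom R L).toLinearMap ∘ₗ TensorAlgebra.ι R

section

attribute [local instance 100] LieRing.ofAssociativeRing

theorem envelopingι_lie (x y : L) :
    envelopingι R ⁅x, y⁆ =
      envelopingι R x * envelopingι R y - envelopingι R y * envelopingι R x :=
  (LieHom.map_lie (UniversalEnvelopingAlgebra.ι R) x y).trans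
    (LieRing.of_associative_ring_bracket _ _)

/-- The algebra map from the universal enveloping algebra induced by a linear map that turns Lie
brackets into commutators. -/
noncomputable def envelopingLift (f : L →ₗ[R] A) (hf : ∀ x y, f ⁅x, y⁆ = f x * f y - f y * f x) :
    UniversalEnvelopingAlgebra R L →ₐ[R] A :=
  UniversalEnvelopingAlgebra.lift R
    { f with
      map_lie' := fun {x y} =>
        (hf x y).trans (LieRing.of_associative_ring_bracket _ _).symm }

@[simp]
theorem envelopingLift_ι (f : L →ₗ[R] A) (hf : ∀ x y, f ⁅x, y⁆ = f x * f y - f y * f x) (x : L) :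
    envelopingLift f hf (envelopingι R x) = f x :=
  UniversalEnvelopingAlgebra.lift_ι_apply' R _ x

end

variable (b : Module.Basis J R L)

/-- The monomial of the universal enveloping algebra given by a word in the vectors of a basis. -/
noncomputable def envelopingWord (l : List J) : UniversalEnvelopingAlgebra R L :=
  wordProd (fun j => envelopingι R (b j)) l

@[simp]
theorem envelopingWord_nil : envelopingWord b [] = 1 := rfl

@[simp]
theorem envelopingWord_cons (j : J) (l : List J) :
    envelopingWord b (j :: l) = envelopingι R (b j) * envelopingWord b l :=
  wordProd_cons _ _ _

theorem mkAlgHom_wordBasis (l : List J) :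
    UniversalEnvelopingAlgebra.mkAlgHom R L (wordBasis b l) = envelopingWord b l := by
  rw [wordBasis_apply, map_wordProd]
  rfl

variable [LinearOrder J]

theorem mul_lieRelator_mul_mem (s t : TensorAlgebra R L) (a c : L) :
    s * lieRelator a c * t ∈ Submodule.span R (⋃ w, swapRelators b w) := by
  refine map_lieRelator_mem b (LinearMap.mulLeftRight R (s, t)) (fun x y hyx => ?_) a c
  refine map_mem_of_forall_basis (wordBasis b)
    (LinearMap.mulRight R t ∘ₗ LinearMap.mulRight R (lieRelator (b x) (b y))) (fun u => ?_) s
  refine map_mem_of_forall_basis (wordBasis b)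
    (LinearMap.mulLeft R (wordBasis b u * lieRelator (b x) (b y))) (fun v => ?_) t
  exact Submodule.subset_span (Set.mem_iUnion.2 ⟨_, u, x, y, v, hyx, rfl, rfl⟩)

theorem ker_mkAlgHom_le :
    LinearMap.ker (UniversalEnvelopingAlgebra.mkAlgHom R L).toLinearMap ≤
      Submodule.span R (⋃ w, swapRelators b w) := by
  let K := Submodule.span R (⋃ w, swapRelators b w)
  have mul_left {s r} (hr : r ∈ K) : s * r ∈ K := by
    refine Submodule.span_le (p := K.comap (LinearMap.mulLeft R s)).2
      (Set.iUnion_subset ?_) hr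
    rintro w _ ⟨u, x, y, v, -, -, rfl⟩
    simpa [mul_assoc] using mul_lieRelator_mul_mem b (s * wordBasis b u) (wordBasis b v) (b x) (b y)
  have mul_right {r s} (hr : r ∈ K) : r * s ∈ K := by
    refine Submodule.span_le (p := K.comap (LinearMap.mulRight R s)).2
      (Set.iUnion_subset ?_) hr
    rintro w _ ⟨u, x, y, v, -, -, rfl⟩
    simpa [mul_assoc] using mul_lieRelator_mul_mem b (wordBasis b u) (wordBasis b v * s) (b x) (b y)
  let I : TwoSidedIdeal (TensorAlgebra R L) :=
    .mk' K K.zero_mem K.add_mem K.neg_mem mul_left mul_right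
  let π := RingCon.mkₐ R I.ringCon
  have hπ (t) : π t = 0 ↔ t ∈ K :=
    ((TwoSidedIdeal.mem_ker (f := I.ringCon.mk')).symm.trans
      (by rw [TwoSidedIdeal.ker_ringCon_mk'])).trans (TwoSidedIdeal.mem_mk' ..)
  have hlie (x y : L) : π (TensorAlgebra.ι R ⁅x, y⁆) =
      π (TensorAlgebra.ι R x) * π (TensorAlgebra.ι R y)
        - π (TensorAlgebra.ι R y) * π (TensorAlgebra.ι R x) := by
    have h := (hπ _).2 (by simpa using mul_lieRelator_mul_mem b 1 1 x y)
    rw [lieRelator_apply, map_sub, map_sub, map_mul, map_mul, sub_eq_zero] at h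
    exact h.symm
  let F := envelopingLift (π.toLinearMap ∘ₗ TensorAlgebra.ι R) hlie
  have hF : F.comp (UniversalEnvelopingAlgebra.mkAlgHom R L) = π := by
    ext x
    exact envelopingLift_ι _ hlie x
  intro t ht
  rw [LinearMap.mem_ker, AlgHom.toLinearMap_apply] at ht
  rw [← hπ, ← hF, AlgHom.comp_apply, ht, map_zero]

theorem linearIndependent_envelopingWord :
    LinearIndependent R fun l : {l : List J // l.Pairwise (· ≤ ·)} => envelopingWord b l := by
  simp only [← mkAlgHom_wordBasis]
  refine ((wordBasis b).linearIndependent.comp _ Subtype.val_injective).map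
    (f := (UniversalEnvelopingAlgebra.mkAlgHom R L).toLinearMap) ?_
  refine (disjoint_span_irreducible_span_relators (wordBasis b).linearIndependent (rk := wordRank)
    (fun _ _ => sub_wordBasis_mem_of_mem_swapRelators)
    fun _ _ hr _ => swapRelators_confluent hr).mono
    (Submodule.span_mono ?_) (ker_mkAlgHom_le b)
  rintro _ ⟨l, rfl⟩
  exact ⟨l, swapRelators_eq_empty_of_pairwise l.2, rfl⟩

variable {b}

theorem envelopingWord_mem_span (l : List J) :
    envelopingWord b l ∈ Submodule.span R
      (envelopingWord b '' {s | s.Pairwise (· ≤ ·) ∧ s.length ≤ l.length}) := by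
  induction l using (InvImage.wf (wordRank (J := J)) wellFounded_lt).induction with
  | _ l ih =>
    by_cases hl : l.Pairwise (· ≤ ·)
    · exact Submodule.subset_span ⟨l, ⟨hl, le_rfl⟩, rfl⟩
    obtain ⟨u, v, x, y, hyx, rfl⟩ := exists_descent_of_not_pairwise hl
    let S := Submodule.span R
      (envelopingWord b '' {s | s.Pairwise (· ≤ ·) ∧ s.length ≤ (u ++ x :: y :: v).length})
    have lower {l' : List J} (hlen : l'.length ≤ (u ++ x :: y :: v).length)
        (hrank : wordRank l' < wordRank (u ++ x :: y :: v)) : envelopingWord b l' ∈ S :=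
      Submodule.span_mono (Set.image_mono fun s hs => And.intro hs.1 (hs.2.trans hlen))
        (ih l' hrank)
    have hswap : envelopingWord b (u ++ y :: x :: v) ∈ S :=
      lower (by simp) (wordRank_swap_lt hyx u v)
    have hbracket : envelopingWord b u * envelopingι R ⁅b x, b y⁆ * envelopingWord b v ∈ S :=
      map_mem_of_forall_basis b (LinearMap.mulLeftRight R
        (envelopingWord b u, envelopingWord b v) ∘ₗ envelopingι R) (S := S) (fun j => by
          have := lower (l' := u ++ j :: v) (by simp) (wordRank_lt_of_length_lt (by simp))
          simpa only [LinearMap.comp_apply, LinearMap.mulLeftRight_apply, envelopingWord,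
            wordProd_append, wordProd_cons, ← mul_assoc] using this)
        ⁅b x, b y⁆
    convert add_mem hswap hbracket using 1
    simp only [envelopingWord, wordProd_append, wordProd_cons, envelopingι_lie]
    noncomm_ring

theorem map_envelopingWord_mem {M : Type*} [AddCommGroup M] [Module R M] {S : Submodule R M}
    (F : UniversalEnvelopingAlgebra R L →ₗ[R] M) (l : List J)
    (h : ∀ s : List J, s.Pairwise (· ≤ ·) → s.length ≤ l.length → F (envelopingWord b s) ∈ S) :
    F (envelopingWord b l) ∈ S := by
  refine Submodule.span_le (p := S.comap F).2 ?_ (envelopingWord_mem_span l)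
  rintro _ ⟨s, ⟨hs, hlen⟩, rfl⟩
  exact h s hs hlen

variable (b)

theorem span_envelopingWord :
    Submodule.span R (Set.range fun l : {l : List J // l.Pairwise (· ≤ ·)} =>
      envelopingWord b l) = ⊤ := by
  rw [Submodule.eq_top_iff']
  intro a
  obtain ⟨t, rfl⟩ : ∃ t, UniversalEnvelopingAlgebra.mkAlgHom R L t = a :=
    RingCon.mkₐ_surjective _ a
  refine map_mem_of_forall_basis (wordBasis b)
    (UniversalEnvelopingAlgebra.mkAlgHom R L).toLinearMap (fun l => ?_) t
  rw [AlgHom.toLinearMap_apply, mkAlgHom_wordBasis]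
  exact map_envelopingWord_mem LinearMap.id l fun s hs _ => Submodule.subset_span ⟨⟨s, hs⟩, rfl⟩

/-- The Poincaré–Birkhoff–Witt basis of the universal enveloping algebra, consisting of the sorted
monomials in the vectors of a basis of the Lie algebra. -/
noncomputable def pbwBasis : Module.Basis {l : List J // l.Pairwise (· ≤ ·)} R
    (UniversalEnvelopingAlgebra R L) :=
  .mk (linearIndependent_envelopingWord b) (span_envelopingWord b).ge

@[simp]
theorem pbwBasis_apply (l : {l : List J // l.Pairwise (· ≤ ·)}) :
    pbwBasis b l = envelopingWord b l :=
  Module.Basis.mk_apply _ _ _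

end PBW

/-! ### Straightening -/

section ScaledBasis

variable {R M J : Type*} [CommRing R] [AddCommGroup M] [Module R M] (κ : Rˣ)
  (b : Module.Basis J R M)

/-- The basis `κ⁻¹ • b`, rescaled so that the factor `κ` in `IsSixHom.rightHom` cancels. -/
noncomputable def scaledBasis : Module.Basis J R M :=
  b.unitsSMul fun _ => κ⁻¹

@[simp]
theorem scaledBasis_apply (j : J) : scaledBasis κ b j = (κ⁻¹ : Rˣ) • b j :=
  Module.Basis.unitsSMul_apply _

end ScaledBasis

/-- A linear map `h` from a Lie algebra to an associative algebra that turns the Lie bracket into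
`bracketSix κ q`, where `q` is an element with `q a q = q a` for all `a`. -/
structure IsSixHom {R L A : Type*} [CommRing R] [LieRing L] [LieAlgebra R L] [Ring A] [Algebra R A]
    (κ : R) (q : A) (h : L →ₗ[R] A) : Prop where
  q_mul_mul_q : ∀ a, q * a * q = q * a
  map_lie : ∀ x y, h ⁅x, y⁆ = bracketSix κ q (h x) (h y)

namespace IsSixHom

variable {R L A J : Type*} [CommRing R] [LieRing L] [LieAlgebra R L] [Ring A] [Algebra R A]
  {q : A} {h : L →ₗ[R] A}

section

variable {κ : R} (H : IsSixHom κ q h)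

include H

theorem q_mul_q : q * q = q := by
  simpa using H.q_mul_mul_q 1

theorem q_mul_mul_q_mul (a c : A) : q * (a * (q * c)) = q * (a * c) := by
  simpa only [mul_assoc] using congrArg (· * c) (H.q_mul_mul_q a)

theorem q_mul_mul_one_sub_q (a : A) : q * a * (1 - q) = 0 := by
  rw [mul_sub, mul_one, H.q_mul_mul_q, sub_self]

theorem one_sub_q_mul_mul_one_sub_q (a : A) : (1 - q) * a * (1 - q) = a * (1 - q) := by
  rw [sub_mul 1 q a, one_mul, sub_mul, H.q_mul_mul_one_sub_q, sub_zero]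

theorem lie_mul_q (x y : L) : h ⁅x, y⁆ * q = κ • (h x * q * h y * q - h y * q * h x * q) := by
  simp only [H.map_lie, bracketSix, add_mul, sub_mul, smul_mul_assoc, mul_assoc, H.q_mul_q,
    smul_sub]
  abel

theorem lie_mul_one_sub_q (x y : L) :
    h ⁅x, y⁆ * (1 - q) = (h x * h y - h y * h x) * (1 - q) := by
  have hq (a c : A) : a * q * c * q = a * q * c := by
    simpa only [mul_assoc] using congrArg (a * ·) (H.q_mul_mul_q c)
  rw [mul_sub, H.lie_mul_q, hq, hq, H.map_lie, bracketSix]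
  simp only [mul_sub, sub_mul, smul_sub, mul_one]
  abel

/-- The algebra map induced by the homomorphism of Lie algebras `x ↦ h x * (1 - q)`. -/
noncomputable def leftHom : UniversalEnvelopingAlgebra R L →ₐ[R] A :=
  envelopingLift (LinearMap.mulRight R (1 - q) ∘ₗ h) fun x y => by
    simp only [LinearMap.comp_apply, LinearMap.mulRight_apply, H.lie_mul_one_sub_q, sub_mul]
    simp only [← mul_assoc, mul_assoc (h _) (1 - q), H.one_sub_q_mul_mul_one_sub_q]

@[simp]
theorem leftHom_ι (a : L) : H.leftHom (envelopingι R a) = h a * (1 - q) :=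
  envelopingLift_ι _ _ a

theorem leftHom_envelopingWord_mul (b : Module.Basis J R L) (l : List J) :
    H.leftHom (envelopingWord b l) * (1 - q) = wordProd (fun j => h (b j)) l * (1 - q) := by
  induction l with
  | nil => simp
  | cons j l ih =>
    rw [envelopingWord_cons, map_mul, leftHom_ι, mul_assoc, ih, mul_assoc, ← mul_assoc (1 - q),
      H.one_sub_q_mul_mul_one_sub_q, wordProd_cons, mul_assoc]

/-- The algebra map induced by the homomorphism of Lie algebras `x ↦ κ • (h x * q)`. -/
noncomputable def rightHom : UniversalEnvelopingAlgebra R L →ₐ[R] A :=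
  envelopingLift (κ • LinearMap.mulRight R q ∘ₗ h) fun x y => by
    simp only [LinearMap.smul_apply, LinearMap.comp_apply, LinearMap.mulRight_apply, H.lie_mul_q,
      smul_mul_assoc, mul_smul_comm, smul_sub, mul_assoc]

@[simp]
theorem rightHom_ι (a : L) : H.rightHom (envelopingι R a) = κ • (h a * q) :=
  envelopingLift_ι _ _ a

end

variable {κ : Rˣ} (H : IsSixHom (κ : R) q h) (b : Module.Basis J R L)

theorem rightHom_envelopingWord_scaledBasis_cons (j : J) (l : List J) :
    H.rightHom (envelopingWord (scaledBasis κ b) (j :: l)) =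
      h (b j) * q * H.rightHom (envelopingWord (scaledBasis κ b) l) := by
  simp [Units.smul_def, smul_smul]

theorem q_mul_rightHom_envelopingWord (l : List J) :
    q * H.rightHom (envelopingWord (scaledBasis κ b) l) = q * wordProd (fun j => h (b j)) l := by
  induction l with
  | nil => simp
  | cons j l ih =>
    rw [H.rightHom_envelopingWord_scaledBasis_cons, mul_assoc, ih, H.q_mul_mul_q_mul, wordProd_cons]

section Straightening

variable [LinearOrder J] {b} {S : Submodule R A}

include H

theorem word_mul_one_sub_q_mul_mem {c : A} {l : List J}
    (hS : ∀ s : List J, s.Pairwise (· ≤ ·) → s.length ≤ l.length →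
      wordProd (fun j => h (b j)) s * (1 - q) * c ∈ S) :
    wordProd (fun j => h (b j)) l * (1 - q) * c ∈ S := by
  simp only [← H.leftHom_envelopingWord_mul, mul_assoc _ _ c] at hS ⊢
  exact map_envelopingWord_mem (LinearMap.mulRight R ((1 - q) * c) ∘ₗ H.leftHom.toLinearMap) l hS

theorem q_mul_word_mem {l : List J}
    (hS : ∀ s : List J, s.Pairwise (· ≤ ·) → q * wordProd (fun j => h (b j)) s ∈ S) :
    q * wordProd (fun j => h (b j)) l ∈ S := by
  simp only [← H.q_mul_rightHom_envelopingWord] at hS ⊢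
  exact map_envelopingWord_mem (LinearMap.mulLeft R q ∘ₗ H.rightHom.toLinearMap) l
    fun s hs _ => hS s hs

/-- Here `x_j q x_l` is straightened as the single word `j :: l` of the enveloping algebra; this is
why the letter to the left of `q` in a middle model monomial precedes those to its right. -/
theorem one_sub_q_mul_mul_q_mul_word_mem {j : J} {l : List J}
    (hS : ∀ (i : J) (s : List J), (i :: s).Pairwise (· ≤ ·) →
      (1 - q) * h (b i) * q * wordProd (fun j => h (b j)) s ∈ S) :
    (1 - q) * h (b j) * q * wordProd (fun j => h (b j)) l ∈ S := by
  let F : UniversalEnvelopingAlgebra R L →ₗ[R] A :=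
    LinearMap.mulLeftRight R (1 - q, q) ∘ₗ H.rightHom.toLinearMap
  have F_cons (i : J) (s : List J) : F (envelopingWord (scaledBasis κ b) (i :: s)) =
      (1 - q) * h (b i) * q * wordProd (fun j => h (b j)) s := by
    calc (1 - q) * H.rightHom (envelopingWord (scaledBasis κ b) (i :: s)) * q
        = (1 - q) * h (b i) * (q * H.rightHom (envelopingWord (scaledBasis κ b) s)) * q := by
          simp only [H.rightHom_envelopingWord_scaledBasis_cons, mul_assoc]
      _ = (1 - q) * h (b i) * (q * wordProd (fun j => h (b j)) s * q) := by
          rw [H.q_mul_rightHom_envelopingWord, mul_assoc _ _ q]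
      _ = (1 - q) * h (b i) * q * wordProd (fun j => h (b j)) s := by
          rw [H.q_mul_mul_q, ← mul_assoc]
  rw [← F_cons]
  refine map_envelopingWord_mem F _ fun s hs _ => ?_
  rcases s with _ | ⟨i, s⟩
  · simp [F, sub_mul, H.q_mul_q]
  · rw [F_cons]
    exact hS i s hs

end Straightening

end IsSixHom

namespace ModelMonomial

variable {J A B : Type*} [LinearOrder J] [Ring A] [Ring B]

/-- The value of a model monomial at elements `q` and `x j` of a ring. -/
def eval (q : A) (x : J → A) : ModelMonomial J → A
  | .qLeft js _ => q * wordProd x js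
  | .qMid is j₀ js _ _ => wordProd x is * x j₀ * q * wordProd x js
  | .noQ js _ => wordProd x js

/-- The model monomials adapted to the decomposition `1 = q + (1 - q)`: a factor `1 - q` is inserted
in front of the letter to the left of `q`, or at the end when there is no `q`. -/
def adapted (q : A) (x : J → A) : ModelMonomial J → A
  | .qLeft js _ => q * wordProd x js
  | .qMid is j₀ js _ _ => wordProd x is * (1 - q) * x j₀ * q * wordProd x js
  | .noQ js _ => wordProd x js * (1 - q)

/-- The number of letters to the left of `q`, which is infinite when `q` does not occur. -/
def leftLength : ModelMonomial J → ℕ∞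
  | .qLeft _ _ => 0
  | .qMid is _ _ _ _ => is.length + 1
  | .noQ _ _ => ⊤

theorem toFree_eq_eval {k : Type*} [Field k] (m : ModelMonomial J) :
    m.toFree k = m.eval (FreeInvariantAlgebra.q k J) (FreeInvariantAlgebra.x k) := by
  cases m <;> rfl

theorem map_eval {F : Type*} [FunLike F A B] [RingHomClass F A B] (f : F) (q : A) (x : J → A)
    (m : ModelMonomial J) : f (m.eval q x) = m.eval (f q) fun j => f (x j) := by
  cases m <;> simp [eval, map_wordProd]

theorem map_adapted {F : Type*} [FunLike F A B] [RingHomClass F A B] (f : F) (q : A) (x : J → A)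
    (m : ModelMonomial J) : f (m.adapted q x) = m.adapted (f q) fun j => f (x j) := by
  cases m <;> simp [adapted, map_wordProd]

end ModelMonomial

theorem map_mem_of_one_mem_of_forall_ι_mul_mem {R A X : Type*} [CommSemiring R]
    [Semiring A] [Algebra R A] {S : Submodule R A}
    (f : FreeAlgebra R X →ₐ[R] A) (h₁ : 1 ∈ S)
    (hmul : ∀ i, ∀ a ∈ S, f (FreeAlgebra.ι R i) * a ∈ S) (t : FreeAlgebra R X) : f t ∈ S := by
  suffices ∀ a ∈ S, f t * a ∈ S by simpa using this 1 h₁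
  induction t with
  | grade0 r =>
    intro a ha
    rw [AlgHom.commutes, ← Algebra.smul_def]
    exact S.smul_mem r ha
  | grade1 i => exact hmul i
  | mul t t' ih ih' =>
    intro a ha
    rw [map_mul, mul_assoc]
    exact ih _ (ih' _ ha)
  | add t t' ih ih' =>
    intro a ha
    rw [map_add, add_mul]
    exact add_mem (ih _ ha) (ih' _ ha)

namespace IsSixHom

variable {R L A J : Type*} [CommRing R] [LieRing L] [LieAlgebra R L] [Ring A] [Algebra R A]
  [LinearOrder J] {κ : Rˣ} {q : A} {h : L →ₗ[R] A} {b : Module.Basis J R L}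

section

variable (q h b)

/-- The span of the adapted monomials with at most `n` letters to the left of `q`. -/
def adaptedSpan (n : ℕ∞) : Submodule R A :=
  Submodule.span R (ModelMonomial.adapted q (fun j => h (b j)) '' {m | m.leftLength ≤ n})

end

theorem adapted_mem_adaptedSpan {n : ℕ∞} (m : ModelMonomial J) (hm : m.leftLength ≤ n) :
    m.adapted q (fun j => h (b j)) ∈ adaptedSpan q h b n :=
  Submodule.subset_span ⟨m, hm, rfl⟩

theorem one_mem_adaptedSpan_top : 1 ∈ adaptedSpan q h b ⊤ := by
  have := add_mem (adapted_mem_adaptedSpan (q := q) (h := h) (b := b) (.qLeft [] .nil) le_top)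
    (adapted_mem_adaptedSpan (q := q) (h := h) (b := b) (.noQ [] .nil) le_top)
  simpa [ModelMonomial.adapted] using this

variable (H : IsSixHom (κ : R) q h)

include H

theorem q_mul_word_mem_adaptedSpan (n : ℕ∞) (l : List J) :
    q * wordProd (fun j => h (b j)) l ∈ adaptedSpan q h b n :=
  H.q_mul_word_mem fun s hs => adapted_mem_adaptedSpan (.qLeft s hs) zero_le

theorem mul_adapted_mem_adaptedSpan (j : J) {n : ℕ∞} (m : ModelMonomial J)
    (hm : m.leftLength ≤ n) :
    h (b j) * m.adapted q (fun j => h (b j)) ∈ adaptedSpan q h b (n + 1) := by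
  cases m with
  | qLeft l hl =>
    have hq : h (b j) * (q * wordProd (fun j => h (b j)) l) =
        q * wordProd (fun j => h (b j)) (j :: l) +
          (1 - q) * h (b j) * q * wordProd (fun j => h (b j)) l := by
      rw [wordProd_cons, ← H.q_mul_mul_q_mul]
      noncomm_ring
    rw [ModelMonomial.adapted, hq]
    refine add_mem (H.q_mul_word_mem_adaptedSpan _ _)
      (H.one_sub_q_mul_mul_q_mul_word_mem fun i s hs => ?_)
    simpa only [ModelMonomial.adapted, wordProd_nil, one_mul] using
      adapted_mem_adaptedSpan (q := q) (h := h) (b := b) (n := n + 1) (.qMid [] i s .nil hs)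
        (by simp [ModelMonomial.leftLength])
  | qMid is i l his hl =>
    have := H.word_mul_one_sub_q_mul_mem (b := b) (l := j :: is)
      (c := h (b i) * q * wordProd (fun j => h (b j)) l)
      (S := adaptedSpan q h b (n + 1)) fun s hs hlen => by
        have hlen' : (s.length : ℕ∞) ≤ is.length + 1 := mod_cast hlen
        simpa only [ModelMonomial.adapted, mul_assoc] using
          adapted_mem_adaptedSpan (n := n + 1) (.qMid s i l hs hl)
            (add_le_add_left (hlen'.trans hm) 1)
    simpa only [ModelMonomial.adapted, wordProd_cons, mul_assoc] using this
  | noQ l hl =>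
    have := H.word_mul_one_sub_q_mul_mem (b := b) (l := j :: l) (c := 1)
      (S := adaptedSpan q h b (n + 1)) fun s hs _ => by
        simpa only [ModelMonomial.adapted, mul_one] using
          adapted_mem_adaptedSpan (n := n + 1) (.noQ s hs) (le_add_right hm)
    simpa only [ModelMonomial.adapted, wordProd_cons, mul_assoc, mul_one] using this

theorem mul_mem_adaptedSpan (j : J) {n : ℕ∞} {a : A} (ha : a ∈ adaptedSpan q h b n) :
    h (b j) * a ∈ adaptedSpan q h b (n + 1) := by
  refine Submodule.span_le (p := (adaptedSpan q h b (n + 1)).comap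
    (LinearMap.mulLeft R (h (b j)))).2 ?_ ha
  rintro _ ⟨m, hm, rfl⟩
  exact H.mul_adapted_mem_adaptedSpan j m hm

theorem word_mul_q_mul_word_mem_adaptedSpan (l l' : List J) :
    wordProd (fun j => h (b j)) l * q * wordProd (fun j => h (b j)) l' ∈
      adaptedSpan q h b l.length := by
  induction l with
  | nil => simpa using H.q_mul_word_mem_adaptedSpan 0 l'
  | cons j l ih => simpa [mul_assoc] using H.mul_mem_adaptedSpan j ih

theorem eval_sub_adapted_mem (m : ModelMonomial J) :
    m.eval q (fun j => h (b j)) - m.adapted q (fun j => h (b j)) ∈ Submodule.span R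
      (ModelMonomial.adapted q (fun j => h (b j)) '' {m' | m'.leftLength < m.leftLength}) := by
  have lower {n : ℕ} (hn : n < m.leftLength) {a : A} (ha : a ∈ adaptedSpan q h b n) :
      a ∈ Submodule.span R
        (ModelMonomial.adapted q (fun j => h (b j)) '' {m' | m'.leftLength < m.leftLength}) :=
    Submodule.span_mono (Set.image_mono fun m' hm' => lt_of_le_of_lt hm' hn) ha
  cases m with
  | qLeft l hl => simp [ModelMonomial.eval, ModelMonomial.adapted]
  | qMid is j l his hl =>
    convert lower (ENat.lt_add_one_iff (ENat.natCast_ne_top _) |>.2 le_rfl)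
      (H.word_mul_q_mul_word_mem_adaptedSpan is (j :: l)) using 1
    rw [ModelMonomial.eval, ModelMonomial.adapted, wordProd_cons, mul_assoc _ q (_ * _),
      ← H.q_mul_mul_q_mul]
    noncomm_ring
  | noQ l hl =>
    convert lower (ENat.natCast_lt_top _) (H.word_mul_q_mul_word_mem_adaptedSpan l []) using 1
    rw [ModelMonomial.eval, ModelMonomial.adapted, wordProd_nil]
    noncomm_ring

theorem linearIndependent_eval
    (hli : LinearIndependent R fun m : ModelMonomial J => m.adapted q fun j => h (b j)) :
    LinearIndependent R fun m : ModelMonomial J => m.eval q fun j => h (b j) :=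
  linearIndependent_of_unitriangular hli H.eval_sub_adapted_mem

theorem adaptedSpan_top_le_span_eval :
    adaptedSpan q h b ⊤ ≤
      Submodule.span R (Set.range fun m : ModelMonomial J => m.eval q fun j => h (b j)) := by
  rw [adaptedSpan]
  simpa using span_le_span_of_unitriangular H.eval_sub_adapted_mem

theorem q_mul_mem_adaptedSpan {n : ℕ∞} {a : A} (ha : a ∈ adaptedSpan q h b n) :
    q * a ∈ adaptedSpan q h b n := by
  refine Submodule.span_le (p := (adaptedSpan q h b n).comap (LinearMap.mulLeft R q)).2 ?_ ha
  rintro _ ⟨m, hm, rfl⟩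
  change q * m.adapted q (fun j => h (b j)) ∈ adaptedSpan q h b n
  cases m with
  | qLeft l hl =>
    rw [ModelMonomial.adapted, ← mul_assoc, H.q_mul_q]
    exact H.q_mul_word_mem_adaptedSpan n l
  | qMid is j l his hl => simp [ModelMonomial.adapted, ← mul_assoc, H.q_mul_mul_one_sub_q]
  | noQ l hl => simp [ModelMonomial.adapted, ← mul_assoc, H.q_mul_mul_one_sub_q]

end IsSixHom

/-! ### The triangular representation -/

section TriangularRepresentation

open TensorProduct

theorem bracketSix_triangular {R A : Type*} [CommRing R] [Ring A] [Algebra R A] (κ : R)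
    (x y x' y' : A) :
    bracketSix κ !![0, 0; 0, 1] !![x, x'; 0, x'] !![y, y'; 0, y'] =
      !![x * y - y * x, κ • (x' * y' - y' * x'); 0, κ • (x' * y' - y' * x')] := by
  ext i j
  fin_cases i <;> fin_cases j <;> simp [bracketSix, smul_sub]

section

variable (R L : Type*) [CommRing R] [LieRing L] [LieAlgebra R L]

/-- The algebra of `2 × 2` matrices over `U(L) ⊗ U(L)`, which carries the triangular
representation of the enveloping algebra of sixth kind. -/
abbrev TensorMatrix : Type _ :=
  Matrix (Fin 2) (Fin 2) (UniversalEnvelopingAlgebra R L ⊗[R] UniversalEnvelopingAlgebra R L)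

end

section

variable {R L J : Type*} [CommRing R] [LieRing L] [LieAlgebra R L] (κ : Rˣ)
  (b : Module.Basis J R L)

/-- The matrix by which an element of `L` acts in the triangular representation; `q` acts by
`!![0, 0; 0, 1]`. -/
noncomputable def lieMatrix : L →ₗ[R] TensorMatrix R L where
  toFun a := !![envelopingι R a ⊗ₜ 1, 1 ⊗ₜ envelopingι R ((κ⁻¹ : Rˣ) • a);
    0, 1 ⊗ₜ envelopingι R ((κ⁻¹ : Rˣ) • a)]
  map_add' a a' := by
    ext i j
    fin_cases i <;> fin_cases j <;> simp [add_tmul, tmul_add]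
  map_smul' c a := by
    ext i j
    fin_cases i <;> fin_cases j <;> simp [smul_tmul', smul_comm _ c]

theorem lieMatrix_apply (a : L) :
    lieMatrix κ a = !![envelopingι R a ⊗ₜ 1, 1 ⊗ₜ envelopingι R ((κ⁻¹ : Rˣ) • a);
      0, 1 ⊗ₜ envelopingι R ((κ⁻¹ : Rˣ) • a)] := rfl

theorem lieMatrix_lie (x y : L) :
    lieMatrix κ ⁅x, y⁆ = bracketSix (κ : R) !![0, 0; 0, 1] (lieMatrix κ x) (lieMatrix κ y) := by
  simp only [lieMatrix_apply, bracketSix_triangular]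
  simp [envelopingι_lie, sub_tmul, tmul_sub, smul_sub, smul_smul, Units.smul_def]

theorem lieMatrix_basis (j : J) :
    lieMatrix κ (b j) = !![envelopingι R (b j) ⊗ₜ 1, 1 ⊗ₜ envelopingι R (scaledBasis κ b j);
      0, 1 ⊗ₜ envelopingι R (scaledBasis κ b j)] := by
  rw [lieMatrix_apply, scaledBasis_apply]

theorem exists_wordProd_lieMatrix (l : List J) :
    ∃ c, wordProd (fun j => lieMatrix κ (b j)) l =
      !![envelopingWord b l ⊗ₜ 1, c; 0, 1 ⊗ₜ envelopingWord (scaledBasis κ b) l] := by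
  induction l with
  | nil => exact ⟨0, by simp [Matrix.one_fin_two, Algebra.TensorProduct.one_def]⟩
  | cons j l ih =>
    obtain ⟨c, hc⟩ := ih
    rw [wordProd_cons, hc, lieMatrix_basis, Matrix.mul_fin_two]
    simp only [mul_zero, add_zero, zero_mul, zero_add, Algebra.TensorProduct.tmul_mul_tmul, mul_one,
      ← envelopingWord_cons]
    exact ⟨_, rfl⟩

/-- The position `(r, s)` and the pair of words `(w, w')` for which the triangular representation
sends the adapted monomial `m` to the matrix with the single entry `w ⊗ w'` at `(r, s)`. -/
def ModelMonomial.matrixIndex [LinearOrder J] : ModelMonomial J →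
    Fin 2 × Fin 2 × {l : List J // l.Pairwise (· ≤ ·)} × {l : List J // l.Pairwise (· ≤ ·)}
  | .qLeft js hjs => (1, 1, ⟨[], .nil⟩, ⟨js, hjs⟩)
  | .qMid is j₀ js his hjs => (0, 1, ⟨is, his⟩, ⟨j₀ :: js, hjs⟩)
  | .noQ js hjs => (0, 0, ⟨js, hjs⟩, ⟨[], .nil⟩)

theorem ModelMonomial.matrixIndex_injective [LinearOrder J] :
    Function.Injective (matrixIndex (J := J)) := by
  rintro (_ | _ | _) (_ | _ | _) h <;> simp_all [matrixIndex]

variable [LinearOrder J]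

theorem adapted_lieMatrix (m : ModelMonomial J) :
    m.adapted !![0, 0; 0, 1] (fun j => lieMatrix κ (b j)) =
      ((pbwBasis b).tensorProduct (pbwBasis (scaledBasis κ b))).matrix (Fin 2) (Fin 2)
        m.matrixIndex := by
  have hp : (1 : TensorMatrix R L) - !![0, 0; 0, 1] = !![1, 0; 0, 0] := by
    rw [Matrix.one_fin_two]
    ext i j
    fin_cases i <;> fin_cases j <;> simp
  cases m with
  | qLeft js hjs =>
    obtain ⟨c, hc⟩ := exists_wordProd_lieMatrix κ b js
    rw [ModelMonomial.adapted, hc]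
    ext i j
    fin_cases i <;> fin_cases j <;> simp [ModelMonomial.matrixIndex, Matrix.single]
  | qMid is j₀ js his hjs =>
    obtain ⟨c, hc⟩ := exists_wordProd_lieMatrix κ b is
    obtain ⟨c', hc'⟩ := exists_wordProd_lieMatrix κ b js
    rw [ModelMonomial.adapted, hc, hc', hp, lieMatrix_basis]
    ext i j
    fin_cases i <;> fin_cases j <;>
      simp [ModelMonomial.matrixIndex, Matrix.single, -scaledBasis_apply]
  | noQ js hjs =>
    obtain ⟨c, hc⟩ := exists_wordProd_lieMatrix κ b js
    rw [ModelMonomial.adapted, hc, hp]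
    ext i j
    fin_cases i <;> fin_cases j <;> simp [ModelMonomial.matrixIndex, Matrix.single]

theorem linearIndependent_adapted_lieMatrix :
    LinearIndependent R fun m : ModelMonomial J =>
      m.adapted !![0, 0; 0, 1] fun j => lieMatrix κ (b j) := by
  simp only [adapted_lieMatrix]
  exact (Module.Basis.linearIndependent _).comp _ ModelMonomial.matrixIndex_injective

end

end TriangularRepresentation

/-! ### The basis of model monomials -/

namespace FreeInvariantAlgebra

variable {k J L : Type*} [Field k] [LieRing L] [LieAlgebra k L] (b : Module.Basis J k L)

@[simp]
theorem hat_basis (j : J) : hat b (b j) = x k j :=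
  b.constr_basis k _ j

variable (κ : kˣ)

/-- The triangular representation on the free algebra. -/
noncomputable def freeToMatrix : FreeAlgebra k (Option J) →ₐ[k] TensorMatrix k L :=
  FreeAlgebra.lift k fun o => o.elim !![0, 0; 0, 1] fun j => lieMatrix κ (b j)

theorem freeToMatrix_apply_one_zero (a : FreeAlgebra k (Option J)) :
    freeToMatrix b κ a 1 0 = 0 := by
  induction a with
  | grade0 r => simp [Matrix.algebraMap_matrix_apply]
  | grade1 o => cases o <;> simp [freeToMatrix, lieMatrix_apply]
  | mul a a' h h' => simp [Matrix.mul_apply, Fin.sum_univ_two, h, h']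
  | add a a' h h' => simp [h, h']

/-- The triangular representation on the free invariant algebra. -/
noncomputable def toMatrix : FreeInvariantAlgebra k J →ₐ[k] TensorMatrix k L :=
  RingQuot.liftAlgHom k ⟨freeToMatrix b κ, by
    have hq : freeToMatrix b κ (FreeAlgebra.ι k none) = !![0, 0; 0, 1] := by
      simp [freeToMatrix]
    rintro _ _ (_ | a)
    · rw [map_mul, hq, Matrix.mul_fin_two]
      simp only [mul_zero, mul_one, add_zero, zero_add]
    · rw [map_mul, map_mul, hq, Matrix.eta_fin_two (freeToMatrix b κ a),
        freeToMatrix_apply_one_zero]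
      simp⟩

@[simp]
theorem toMatrix_q : toMatrix b κ (q k J) = !![0, 0; 0, 1] := by
  rw [toMatrix, q, RingQuot.liftAlgHom_mkAlgHom_apply]
  simp [freeToMatrix]

@[simp]
theorem toMatrix_x (j : J) : toMatrix b κ (x k j) = lieMatrix κ (b j) := by
  rw [toMatrix, x, RingQuot.liftAlgHom_mkAlgHom_apply]
  simp [freeToMatrix]

@[simp]
theorem toMatrix_hat (a : L) : toMatrix b κ (hat b a) = lieMatrix κ a := by
  have : (toMatrix b κ).toLinearMap ∘ₗ hat b = lieMatrix κ := b.ext fun j => by simp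
  exact LinearMap.congr_fun this a

end FreeInvariantAlgebra

namespace EnvelopingSix

variable {k J L : Type*} [Field k] [LieRing L] [LieAlgebra k L] (b : Module.Basis J k L) (κ : kˣ)

/-- The triangular representation of the enveloping algebra of sixth kind. -/
noncomputable def toMatrix : EnvelopingSix (κ : k) b →ₐ[k] TensorMatrix k L :=
  RingQuot.liftAlgHom k ⟨FreeInvariantAlgebra.toMatrix b κ, by
    rintro _ _ ⟨x, y⟩
    simp [bracketSix, lieMatrix_lie]⟩

@[simp]
theorem toMatrix_coset (a : FreeInvariantAlgebra k J) :
    toMatrix b κ (coset (κ : k) b a) = FreeInvariantAlgebra.toMatrix b κ a :=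
  RingQuot.liftAlgHom_mkAlgHom_apply ..

theorem coset_surjective (κ : k) : Function.Surjective (coset κ b) :=
  RingQuot.mkAlgHom_surjective k (EnvelopingSixRel κ b)

/-- The linear map `x ↦ x̂ + R` from the Lie algebra to its enveloping algebra of sixth kind. -/
noncomputable def hatCoset (κ : k) : L →ₗ[k] EnvelopingSix κ b :=
  (coset κ b).toLinearMap ∘ₗ FreeInvariantAlgebra.hat b

@[simp]
theorem hatCoset_basis (κ : k) (j : J) :
    hatCoset b κ (b j) = coset κ b (FreeInvariantAlgebra.x k j) := by
  simp [hatCoset]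

theorem isSixHom_hatCoset (κ : k) :
    IsSixHom κ (coset κ b (FreeInvariantAlgebra.q k J)) (hatCoset b κ) where
  q_mul_mul_q a := by
    obtain ⟨a, rfl⟩ := coset_surjective b κ a
    simpa only [map_mul] using
      congrArg (coset κ b) (FreeInvariantAlgebra.q_mul_mul_q k J a)
  map_lie x y := by
    refine (RingQuot.mkAlgHom_rel k (EnvelopingSixRel.lie (κ := κ) (b := b) x y)).trans ?_
    simp only [bracketSix, map_add, map_sub, map_mul, map_smul]
    rfl

variable [LinearOrder J]

theorem linearIndependent_adapted :
    LinearIndependent k fun m : ModelMonomial J =>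
      m.adapted (coset (κ : k) b (FreeInvariantAlgebra.q k J))
        fun j => coset (κ : k) b (FreeInvariantAlgebra.x k j) := by
  refine .of_comp (toMatrix b κ).toLinearMap ?_
  simpa [Function.comp_def, ModelMonomial.map_adapted] using linearIndependent_adapted_lieMatrix κ b

theorem linearIndependent_toFree :
    LinearIndependent k fun m : ModelMonomial J => coset (κ : k) b (m.toFree k) := by
  simpa [ModelMonomial.toFree_eq_eval, ModelMonomial.map_eval] using
    (isSixHom_hatCoset b (κ : k)).linearIndependent_eval (b := b)
      (by simpa using linearIndependent_adapted b κ)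

theorem mem_adaptedSpan_top (a : EnvelopingSix (κ : k) b) :
    a ∈ IsSixHom.adaptedSpan (coset (κ : k) b (FreeInvariantAlgebra.q k J))
      (hatCoset b (κ : k)) b ⊤ := by
  have H := isSixHom_hatCoset b (κ : k)
  obtain ⟨a, rfl⟩ := coset_surjective b (κ : k) a
  obtain ⟨a, rfl⟩ := RingQuot.mkAlgHom_surjective k (InvariantRel k J) a
  refine map_mem_of_one_mem_of_forall_ι_mul_mem
    ((coset (κ : k) b).comp (RingQuot.mkAlgHom k (InvariantRel k J)))
    IsSixHom.one_mem_adaptedSpan_top (fun o c hc => ?_) a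
  rcases o with _ | j
  · exact H.q_mul_mem_adaptedSpan hc
  · have := H.mul_mem_adaptedSpan j hc
    rwa [hatCoset_basis, top_add] at this

theorem span_toFree : Submodule.span k
    (Set.range fun m : ModelMonomial J => coset (κ : k) b (m.toFree k)) = ⊤ := by
  rw [Submodule.eq_top_iff']
  intro a
  have := (isSixHom_hatCoset b (κ : k)).adaptedSpan_top_le_span_eval (mem_adaptedSpan_top b κ a)
  simpa [ModelMonomial.toFree_eq_eval, ModelMonomial.map_eval] using this

end EnvelopingSix

theorem proposition6p3 {k L J : Type*} [Field k] [LieRing L] [LieAlgebra k L] [LinearOrder J]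
    (b : Module.Basis J k L) (κ : k) (hκ : κ ≠ 0) :
    LinearIndependent k
        (fun m : ModelMonomial J => EnvelopingSix.coset κ b (m.toFree k)) ∧
      Submodule.span k
        (Set.range fun m : ModelMonomial J => EnvelopingSix.coset κ b (m.toFree k)) = ⊤ := by
  obtain ⟨κ, rfl⟩ := hκ.isUnit
  exact ⟨EnvelopingSix.linearIndependent_toFree b κ, EnvelopingSix.span_toFree b κ⟩
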